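/- Let $G=(V,E)$ be a finite graph, possibly with loops or multiple edges. For $H\subseteq E$ and $v\in V$ let $\deg(H,v)$ be the degree of $v$ in the spanning subgraph $(V,H)$ (a loop at $v$ counts twice), and let $\deg(G,v)=\deg(E,v)$. Given edge weights $\lambda=(\lambda_e)_{e\in E}$ and vertex activities $u=(u^{(v)}_k)$, define $$Z(G,\lambda,u;x)=\sum_{H\subseteq E}\Big(\prod_{e\in H}\lambda_e\Big)\Big(\prod_{v\in V}u^{(v)}_{\deg(H,v)}\,x_v^{\deg(H,v)}\Big),\qquad K_v(z)=\sum_{j=0}^{d}\binom{d}{j}u^{(v)}_j z^j\quad(d=\deg(G,v)),$$ where $K_v$ is called the key polynomial at $v$. The univariate specialization $Z(G,\lambda,u;y^{1/2}\mathbf 1)$, obtained by setting every $x_v=y^{1/2}$, is a polynomial in $y$, namely $\sum_{H\subseteq E}\big(\prod_{e\in H}\lambda_e\big)\big(\prod_{v\in V}u^{(v)}_{\deg(H,v)}\big)y^{|H|}$. For $0<\theta\le\pi$ let $S[\theta]=\{z\in\mathbb C: z\ne 0,\ |\arg z|<\theta\}$, with $-\pi<\arg z\le\pi$. For $A\subseteq\mathbb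 C$, a complex polynomial is called $A$-nonvanishing if it is identically zero, or it is nonzero at every point all of whose coordinates lie in $A$. Statement. For every $\Delta\in\mathbb N$ there is $\varepsilon$ with $0<\varepsilon\le\pi/2$, depending only on $\Delta$, such that the following holds for every finite graph $G=(V,E)$ in which every vertex has degree at most $\Delta$, all nonnegative real edge weights $\lambda$, and all functions $f,g:V\to\mathbb N$ with $f(v)\le g(v)\le f(v)+3$ for every $v\in V$. Let $u^{(v)}_k=1$ if $f(v)\le k\le g(v)$ and $u^{(v)}_k=0$ otherwise. Then: 1. for every $v\in V$, the key polynomial $K_v(z)$ is $S[\pi/2+\varepsilon]$-nonvanishing; 2. $Z(G,\lambda,u;x)$ is $S[\varepsilon]$-nonvanishing; 3. $Z(G,\lambda,u;y^{1/2}\mathbf 1)$ is $S[2\varepsilon]$-nonvanishing as a polynomial in $y$. -/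

import Mathlib

open scoped Graph

noncomputable section

namespace SpanningSubgraph

/-- A polynomial in several complex variables is `A`-nonvanishing if it is identically zero, or it
does not vanish at any point all of whose coordinates lie in `A`. -/
def Nonvanishing {σ : Type*} (A : Set ℂ) (F : MvPolynomial σ ℂ) : Prop :=
  F = 0 ∨ ∀ z : σ → ℂ, (∀ i, z i ∈ A) → MvPolynomial.eval z F ≠ 0

/-- `A`-nonvanishing for polynomials in one variable. -/
def Nonvanishing₁ (A : Set ℂ) (F : Polynomial ℂ) : Prop :=
  F = 0 ∨ ∀ z ∈ A, F.eval z ≠ 0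

/-- The open sector `S[θ]` centered on the positive real axis. -/
def sector (θ : ℝ) : Set ℂ := {z | z ≠ 0 ∧ |Complex.arg z| < θ}

section Graphs

variable {α β : Type*} (G : Graph α β)

open Classical in
/-- `deg(H, v)`: the degree of the vertex `v` in the spanning subgraph with edge set `H`. A loop
at `v` contributes two. -/
def deg (H : Finset E(G)) (v : V(G)) : ℕ :=
  ∑ e ∈ H, if G.IsLoopAt e v then 2 else if G.Inc e v then 1 else 0

variable [Fintype E(G)]

/-- The key polynomial `K_v(z) = ∑_{j=0}^d binom(d,j) u_j^{(v)} z^j`, with `d = deg(G,v)`. -/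
def keyPoly (u : V(G) → ℕ → ℂ) (v : V(G)) : Polynomial ℂ :=
  ∑ j ∈ Finset.range (deg G Finset.univ v + 1),
    Polynomial.C (((deg G Finset.univ v).choose j : ℂ) * u v j) * Polynomial.X ^ j

variable [Fintype V(G)]

/-- The product of `λ^H = ∏_{e ∈ H} λ_e` and `u_{deg(H)} = ∏_v u^{(v)}_{deg(H,v)}`. -/
def weight (lam : E(G) → ℂ) (u : V(G) → ℕ → ℂ) (H : Finset E(G)) : ℂ :=
  (∏ e ∈ H, lam e) * ∏ v : V(G), u v (deg G H v)

/-- `Z(G, λ, u; x) = ∑_{H ⊆ E} λ^H u_{deg(H)} x^{deg(H)}`. -/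
def Z (lam : E(G) → ℂ) (u : V(G) → ℕ → ℂ) : MvPolynomial V(G) ℂ :=
  ∑ H : Finset E(G), MvPolynomial.C (weight G lam u H) *
    ∏ v : V(G), MvPolynomial.X v ^ deg G H v

/-- The univariate specialization `Z(G, λ, u; y^{1/2} 1) = ∑_{H ⊆ E} λ^H u_{deg(H)} y^{|H|}`,
as a polynomial in `y`; see `Z_uni_eval` for the agreement with the substitution. -/
def Z_uni (lam : E(G) → ℂ) (u : V(G) → ℕ → ℂ) : Polynomial ℂ :=
  ∑ H : Finset E(G), Polynomial.C (weight G lam u H) * Polynomial.X ^ H.card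

theorem sum_deg (H : Finset E(G)) : ∑ v : V(G), deg G H v = 2 * H.card := by
  classical
  unfold deg
  rw [Finset.sum_comm, Finset.sum_congr rfl (g := fun _ => 2), Finset.sum_const, smul_eq_mul,
    mul_comm]
  intro e _
  obtain ⟨x, y, h⟩ := Graph.exists_isLink_of_mem_edgeSet e.2
  by_cases hxy : x = y
  · subst hxy
    rw [Finset.sum_eq_single (⟨x, h.left_mem⟩ : V(G))]
    · exact if_pos h
    · intro v _ hv
      have hn : ¬ G.Inc e v := fun h' => hv (Subtype.ext (by
        rcases h'.eq_or_eq_of_isLink h with h1 | h1 <;> exact h1))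
      rw [if_neg (fun h' => hn h'.inc), if_neg hn]
    · simp
  · have hl : ∀ v : V(G), ¬ G.IsLoopAt e v := fun v hv =>
      hxy ((hv.eq_of_inc h.inc_left).symm.trans (hv.eq_of_inc h.inc_right))
    rw [Finset.sum_eq_add (⟨x, h.left_mem⟩ : V(G)) ⟨y, h.right_mem⟩]
    · rw [if_neg (hl _), if_neg (hl _), if_pos h.inc_left, if_pos h.inc_right]
    · exact fun h' => hxy (congrArg Subtype.val h')
    · intro v _ hv
      rw [if_neg (hl _), if_neg]
      intro h'
      rcases h'.eq_or_eq_of_isLink h with h1 | h1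
      · exact hv.1 (Subtype.ext h1)
      · exact hv.2 (Subtype.ext h1)
    · simp
    · simp

theorem Z_uni_eval_sq (lam : E(G) → ℂ) (u : V(G) → ℕ → ℂ) (w : ℂ) :
    (Z_uni G lam u).eval (w ^ 2) = MvPolynomial.eval (fun _ => w) (Z G lam u) := by
  simp only [Z_uni, Z, Polynomial.eval_finsetSum, map_sum, map_mul, map_prod, map_pow,
    Polynomial.eval_mul, Polynomial.eval_pow, Polynomial.eval_C, Polynomial.eval_X,
    MvPolynomial.eval_C, MvPolynomial.eval_X, Finset.prod_pow_eq_pow_sum, sum_deg, pow_mul]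

theorem Z_uni_eval (lam : E(G) → ℂ) (u : V(G) → ℕ → ℂ) (y : ℂ) :
    (Z_uni G lam u).eval y = MvPolynomial.eval (fun _ => y ^ (1 / 2 : ℂ)) (Z G lam u) := by
  rw [← Z_uni_eval_sq]
  congr 1
  rw [← Complex.cpow_nat_mul]
  simp

end Graphs

/-- The indicator activities: `u_k^{(v)} = 1` if `f(v) ≤ k ≤ g(v)`, and `0` otherwise. -/
def indicatorActivity {V : Type*} (f g : V → ℕ) (v : V) (k : ℕ) : ℂ :=
  if f v ≤ k ∧ k ≤ g v then 1 else 0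

end SpanningSubgraph

end

/-! With all activities equal to 1, `Z` factors over the edges as a product of terms `1 + λ_e x_v
x_w`, which cannot vanish when all `x_v` lie in the open right half-plane. Activities are then
inserted one vertex at a time. As a polynomial in the variable at `v`, the sum so far has no zero
with positive real part. Replacing `x_v ^ j` by the `j`-th coefficient of a polynomial `Q v` over
`binom(d,j)` is an apolar pairing, which Grace's theorem (`apolar_pairing_ne_zero`) keeps nonzero if
`Q v` has full degree and all its zeros in the open left half-plane. Grace's theorem itself follows
by iterating Laguerre's theorem on polar derivatives, one root of `Q v` at a time.

For a point `x` with coordinates in `S[ε]`, this is applied to `z ↦ K_v(x_v z)`: the right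
half-plane is rotated into `S[π/2 + ε]`, where `K_v` has no zeros. Key polynomials with zeros at 0
or of deficient degree are reached as limits, through a Hurwitz-type argument in `nonvanishing_Z`.

It remains to find `ε`. A window of at most four consecutive binomial coefficients is a power of `z`
times a polynomial of degree at most three. Strict log-concavity gives the Hurwitz condition, so its
nonzero zeros have negative real part. For degrees at most `Δ` there are finitely many nonzero
windows, hence a common angular margin. -/

namespace SpanningSubgraph

/-! ### Grace's theorem for the right half-plane -/

/-- Inverses of points of the half-plane `x ≤ Re z` lie in a disk tangent to the imaginary axis. -/
theorem norm_two_mul_inv_sub_one_le {x : ℝ} (hx : 0 < x) {z : ℂ} (hz : x ≤ z.re) :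
    ‖2 * (x : ℂ) * (1 / z) - 1‖ ≤ 1 := by
  have hz0 : z ≠ 0 := by
    rintro rfl
    simp at hz
    linarith
  have h : 2 * (x : ℂ) * (1 / z) - 1 = (2 * x - z) / z := by
    field_simp
  rw [h, norm_div, div_le_one (norm_pos_iff.2 hz0), Complex.norm_def, Complex.norm_def]
  apply Real.sqrt_le_sqrt
  simp only [Complex.normSq_apply, Complex.sub_re, Complex.sub_im, Complex.mul_re, Complex.mul_im,
    Complex.ofReal_re, Complex.ofReal_im, Complex.re_ofNat, Complex.im_ofNat]
  nlinarith

theorem norm_mul_multiset_sum_sub_card_le (x : ℂ) (s : Multiset ℂ)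
    (h : ∀ w ∈ s, ‖x * w - 1‖ ≤ 1) : ‖x * s.sum - Multiset.card s‖ ≤ Multiset.card s := by
  induction s using Multiset.induction with
  | empty => simp
  | cons a s ih =>
    have h1 := ih fun w hw => h w (Multiset.mem_cons_of_mem hw)
    have h2 := h a (Multiset.mem_cons_self a s)
    rw [Multiset.sum_cons, Multiset.card_cons]
    push_cast
    calc ‖x * (a + s.sum) - (Multiset.card s + 1)‖
        = ‖(x * s.sum - Multiset.card s) + (x * a - 1)‖ := by congr 1; ring
      _ ≤ _ := (norm_add_le _ _).trans (add_le_add h1 h2)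

/-- Laguerre's theorem: the polar derivative, with pole in the open right half-plane, of a
polynomial without zeros there has no zeros there either. -/
theorem polar_derivative_ne_zero {d : ℕ} {p : Polynomial ℂ} (hd : p.natDegree ≤ d) (hd0 : 0 < d)
    (hp : ∀ t : ℂ, 0 < t.re → p.eval t ≠ 0) {a t : ℂ} (ha : 0 < a.re) (ht : 0 < t.re) :
    d * p.eval t + (a - t) * p.derivative.eval t ≠ 0 := by
  intro h0
  have hsum := (IsAlgClosed.splits p).eval_derivative_div_eval_of_ne_zero (hp t ht)
  set s : Multiset ℂ := p.roots.map fun z => 1 / (t - z) with hs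
  have hcard : Multiset.card s ≤ d := by
    rw [hs, Multiset.card_map]
    exact (Polynomial.card_roots' p).trans hd
  have h1 : ‖(2 * (t.re : ℂ)) * s.sum - Multiset.card s‖ ≤ Multiset.card s := by
    apply norm_mul_multiset_sum_sub_card_le
    intro w hw
    obtain ⟨z, hz, rfl⟩ := Multiset.mem_map.1 hw
    apply norm_two_mul_inv_sub_one_le ht
    have : z.re ≤ 0 := by
      by_contra! hz0
      exact hp z hz0 (Polynomial.isRoot_of_mem_roots hz)
    simp only [Complex.sub_re]
    linarith
  -- Each missing degree is a root at infinity: it contributes the term 0, at distance 1 from the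
  -- centre of the disk.
  have h2 : ‖(2 * (t.re : ℂ)) * s.sum - d‖ ≤ d := by
    calc ‖(2 * (t.re : ℂ)) * s.sum - d‖
        = ‖((2 * (t.re : ℂ)) * s.sum - Multiset.card s) - ((d - Multiset.card s : ℕ) : ℂ)‖ := by
          rw [Nat.cast_sub hcard]; congr 1; ring
      _ ≤ Multiset.card s + ((d - Multiset.card s : ℕ) : ℝ) := by
          refine (norm_sub_le _ _).trans (add_le_add h1 ?_)
          rw [Complex.norm_natCast]
      _ = d := by rw [Nat.cast_sub hcard]; ring
  have h3 : (t - a) * s.sum = d := by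
    rw [← hsum]
    field_simp [hp t ht]
    linear_combination -h0
  have hd' : (0 : ℝ) < d := by exact_mod_cast hd0
  -- By `h3` the average `s.sum / d` is `1 / (t - a)`, so it lies in the disk of `h2`; inverting
  -- back, this forces `a.re ≤ 0`.
  have h4 : ‖2 * (t.re : ℂ) - (t - a)‖ * d ≤ ‖t - a‖ * d := by
    calc ‖2 * (t.re : ℂ) - (t - a)‖ * d = ‖(2 * (t.re : ℂ) - (t - a)) * d‖ := by
          rw [norm_mul, Complex.norm_natCast]
      _ = ‖(t - a) * ((2 * (t.re : ℂ)) * s.sum - d)‖ := by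
          congr 1
          linear_combination (-2 * (t.re : ℂ)) * h3
      _ ≤ _ := by
          rw [norm_mul]
          gcongr
  have h5 := le_of_mul_le_mul_right h4 hd'
  have h6 : ‖2 * (t.re : ℂ) - (t - a)‖ ^ 2 ≤ ‖t - a‖ ^ 2 := by gcongr
  rw [Complex.sq_norm, Complex.sq_norm] at h6
  simp only [Complex.normSq_apply, Complex.sub_re, Complex.sub_im, Complex.mul_re, Complex.mul_im,
    Complex.ofReal_re, Complex.ofReal_im, Complex.re_ofNat, Complex.im_ofNat] at h6
  nlinarith [mul_pos ha ht]

theorem coeff_polar (d : ℕ) (a : ℂ) (p : Polynomial ℂ) (j : ℕ) :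
    ((d : Polynomial ℂ) * p + (Polynomial.C a - Polynomial.X) * p.derivative).coeff j
      = (d - j) * p.coeff j + a * ((j + 1) * p.coeff (j + 1)) := by
  rw [Polynomial.coeff_add, sub_mul, Polynomial.coeff_sub, Polynomial.coeff_C_mul,
    Polynomial.coeff_natCast_mul]
  cases j with
  | zero => simp [Polynomial.coeff_derivative]
  | succ j =>
    rw [Polynomial.coeff_X_mul, Polynomial.coeff_derivative, Polynomial.coeff_derivative]
    push_cast
    ring

/-- The apolar pairing with `(1 + aX) q` in degree `d + 1` is the pairing of the polar derivative
with `q` in degree `d`. -/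
theorem apolar_pairing_succ (d : ℕ) (a : ℂ) (p q : Polynomial ℂ) (hq : q.natDegree ≤ d) :
    ((d + 1 : ℕ) : ℂ) * ∑ j ∈ Finset.range (d + 1 + 1), p.coeff j *
        (((1 + Polynomial.C a * Polynomial.X) * q).coeff j / ((d + 1).choose j : ℂ))
      = ∑ j ∈ Finset.range (d + 1),
        (((d + 1 : ℕ) : Polynomial ℂ) * p +
          (Polynomial.C a - Polynomial.X) * p.derivative).coeff j *
          (q.coeff j / (d.choose j : ℂ)) := by
  have hc : ∀ j, ((1 + Polynomial.C a * Polynomial.X) * q).coeff j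
      = q.coeff j + a * (Polynomial.X * q).coeff j := by
    intro j
    rw [add_mul, one_mul, mul_assoc, Polynomial.coeff_add, Polynomial.coeff_C_mul]
  have h1 : ∀ j, p.coeff j * ((q.coeff j + a * (Polynomial.X * q).coeff j) / ((d + 1).choose j : ℂ))
      = p.coeff j * (q.coeff j / ((d + 1).choose j : ℂ))
        + p.coeff j * (a * (Polynomial.X * q).coeff j / ((d + 1).choose j : ℂ)) := by
    intro j
    ring
  have h2 : ∀ j : ℕ, ((((d + 1 : ℕ) : ℂ) - j) * p.coeff j + a * ((j + 1) * p.coeff (j + 1)))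
        * (q.coeff j / (d.choose j : ℂ))
      = (((d + 1 : ℕ) : ℂ) - j) * p.coeff j * (q.coeff j / (d.choose j : ℂ))
        + a * ((j + 1) * p.coeff (j + 1)) * (q.coeff j / (d.choose j : ℂ)) := by
    intro j
    ring
  simp only [hc, coeff_polar, h1, h2, Finset.sum_add_distrib, mul_add ((d + 1 : ℕ) : ℂ)]
  congr 1
  · rw [Finset.sum_range_succ, Polynomial.coeff_eq_zero_of_natDegree_lt (Nat.lt_succ_of_le hq),
      zero_div, mul_zero, add_zero, Finset.mul_sum]
    refine Finset.sum_congr rfl fun j hj => ?_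
    have hj' : j ≤ d := Nat.lt_succ_iff.1 (Finset.mem_range.1 hj)
    have h1 : ((d.choose j : ℕ) : ℂ) ≠ 0 := Nat.cast_ne_zero.2 (Nat.choose_pos hj').ne'
    have h2 : (((d + 1).choose j : ℕ) : ℂ) ≠ 0 :=
      Nat.cast_ne_zero.2 (Nat.choose_pos (hj'.trans d.le_succ)).ne'
    have h3 := congrArg (Nat.cast : ℕ → ℂ) (Nat.choose_mul_succ_eq d j)
    push_cast [Nat.cast_sub (hj'.trans d.le_succ)] at h3
    field_simp
    push_cast
    linear_combination p.coeff j * q.coeff j * h3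
  · rw [Finset.sum_range_succ']
    simp only [Polynomial.coeff_X_mul, Polynomial.mul_coeff_zero, Polynomial.coeff_X_zero,
      zero_mul, mul_zero, zero_div, add_zero]
    rw [Finset.mul_sum]
    refine Finset.sum_congr rfl fun j hj => ?_
    have hj' : j ≤ d := Nat.lt_succ_iff.1 (Finset.mem_range.1 hj)
    have h1 : ((d.choose j : ℕ) : ℂ) ≠ 0 := Nat.cast_ne_zero.2 (Nat.choose_pos hj').ne'
    have h2 : (((d + 1).choose (j + 1) : ℕ) : ℂ) ≠ 0 :=
      Nat.cast_ne_zero.2 (Nat.choose_pos (Nat.succ_le_succ hj')).ne'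
    have h3 := congrArg (Nat.cast : ℕ → ℂ) (Nat.add_one_mul_choose_eq d j)
    push_cast at h3
    field_simp
    push_cast
    linear_combination p.coeff (j + 1) * q.coeff j * a * h3

/-- Grace's theorem for the right half-plane. -/
theorem apolar_pairing_ne_zero (d : ℕ) : ∀ p q : Polynomial ℂ, p.natDegree ≤ d →
    (∀ t : ℂ, 0 < t.re → p.eval t ≠ 0) → q.natDegree = d → q ≠ 0 →
    (∀ z : ℂ, 0 ≤ z.re → q.eval z ≠ 0) →
    ∑ j ∈ Finset.range (d + 1), p.coeff j * (q.coeff j / (d.choose j : ℂ)) ≠ 0 := by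
  induction d with
  | zero =>
    intro p q hpd hp _ _ hq
    have h1 := hp 1 (by simp)
    have h2 := hq 0 (by simp)
    rw [Polynomial.eq_C_of_natDegree_le_zero hpd, Polynomial.eval_C] at h1
    rw [← Polynomial.coeff_zero_eq_eval_zero] at h2
    simp [h1, h2]
  | succ d ih =>
    intro p q hpd hp hqd hq0 hq
    obtain ⟨ρ, hρ⟩ := IsAlgClosed.exists_root q
      (by rw [Polynomial.degree_eq_natDegree hq0, hqd]; exact_mod_cast d.succ_ne_zero)
    have hρre : ρ.re < 0 := by
      by_contra! h
      exact hq ρ h hρ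
    have hρ0 : ρ ≠ 0 := by
      rintro rfl
      simp at hρre
    obtain ⟨r, hr⟩ := Polynomial.dvd_iff_isRoot.2 hρ
    -- Normalizing the factor of the root `ρ` to constant term 1 exhibits the pole `-ρ⁻¹`, which
    -- lies in the right half-plane because `ρ` lies in the left one.
    have hr' : q = (1 + Polynomial.C (-ρ⁻¹) * Polynomial.X) * (Polynomial.C (-ρ) * r) := by
      have : Polynomial.C ρ⁻¹ * Polynomial.C ρ = 1 := by
        rw [← Polynomial.C_mul, inv_mul_cancel₀ hρ0, Polynomial.C_1]
      rw [hr]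
      simp only [Polynomial.C_neg]
      linear_combination (-Polynomial.X * r) * this
    set s := Polynomial.C (-ρ) * r with hs
    have hr0 : r ≠ 0 := by
      rintro rfl
      exact hq0 (by simpa using hr)
    have hrd : r.natDegree = d := by
      rw [hr, Polynomial.natDegree_mul (Polynomial.X_sub_C_ne_zero ρ) hr0,
        Polynomial.natDegree_X_sub_C] at hqd
      omega
    have hsd : s.natDegree = d := by
      rw [hs, Polynomial.natDegree_C_mul (neg_ne_zero.2 hρ0), hrd]
    have ha : 0 < (-ρ⁻¹).re := by
      rw [Complex.neg_re, Complex.inv_re, ← neg_div]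
      exact div_pos (by linarith) (Complex.normSq_pos.2 hρ0)
    have key := apolar_pairing_succ d (-ρ⁻¹) p s hsd.le
    rw [← hr'] at key
    refine fun h0 => ih _ s ?_ ?_ hsd ?_ ?_ (key.symm.trans (by rw [h0, mul_zero]))
    · rw [Polynomial.natDegree_le_iff_coeff_eq_zero]
      intro j hj
      rw [coeff_polar, Polynomial.coeff_eq_zero_of_natDegree_lt (n := j + 1) (by omega)]
      -- The degree really drops: the coefficient at `d + 1` carries the factor `(d + 1) - (d + 1)`.
      rcases eq_or_ne j (d + 1) with rfl | hne
      · simp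
      · rw [Polynomial.coeff_eq_zero_of_natDegree_lt (n := j) (by omega)]
        simp
    · intro t ht
      have := polar_derivative_ne_zero hpd d.succ_pos hp ha ht
      simpa using this
    · exact mul_ne_zero (Polynomial.C_ne_zero.2 (neg_ne_zero.2 hρ0)) hr0
    · intro z hz h0
      apply hq z hz
      rw [hr', Polynomial.eval_mul, h0, mul_zero]

/-! ### Replacing powers by activities, one vertex at a time -/

/-- Multiplying by the conjugate of `z` gives the real part `z.re + r * w.re * |z|²`, which is
positive. -/
theorem one_add_mul_mul_ne_zero {r : ℝ} (hr : 0 ≤ r) {z w : ℂ} (hz : 0 < z.re) (hw : 0 < w.re) :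
    1 + r * (z * w) ≠ 0 := by
  intro h
  have h1 := congrArg Complex.re h
  have h2 := congrArg Complex.im h
  simp only [Complex.add_re, Complex.add_im, Complex.one_re, Complex.one_im, Complex.mul_re,
    Complex.mul_im, Complex.ofReal_re, Complex.ofReal_im, Complex.zero_re, Complex.zero_im] at h1 h2
  have h3 : z.re + r * w.re * (z.re ^ 2 + z.im ^ 2) = 0 := by
    linear_combination z.re * h1 + z.im * h2
  have h4 : 0 ≤ r * w.re * (z.re ^ 2 + z.im ^ 2) := by positivity
  linarith

section Graphs

variable {α β : Type*} (G : Graph α β)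

theorem deg_mono {H H' : Finset E(G)} (h : H ⊆ H') (v : V(G)) : deg G H v ≤ deg G H' v :=
  Finset.sum_le_sum_of_subset h

theorem deg_eq_sum_singleton (H : Finset E(G)) (v : V(G)) :
    deg G H v = ∑ e ∈ H, deg G {e} v := by
  simp [deg]

theorem prod_pow_deg_singleton [Fintype V(G)] (t : V(G) → ℂ) (e : E(G)) :
    ∃ x y : V(G), ∏ v, t v ^ deg G {e} v = t x * t y := by
  obtain ⟨x, y, h⟩ := Graph.exists_isLink_of_mem_edgeSet e.2
  refine ⟨⟨x, h.left_mem⟩, ⟨y, h.right_mem⟩, ?_⟩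
  simp only [deg, Finset.sum_singleton]
  by_cases hxy : x = y
  · subst hxy
    rw [Finset.prod_eq_single (⟨x, h.left_mem⟩ : V(G))]
    · rw [if_pos (show G.IsLoopAt e x from h), sq]
    · intro v _ hv
      have hn : ¬ G.Inc e v := fun h' => hv (Subtype.ext (by
        rcases h'.eq_or_eq_of_isLink h with h1 | h1 <;> exact h1))
      rw [if_neg (fun h' => hn h'.inc), if_neg hn, pow_zero]
    · simp
  · have hl : ∀ v : V(G), ¬ G.IsLoopAt e v := fun v hv =>
      hxy ((hv.eq_of_inc h.inc_left).symm.trans (hv.eq_of_inc h.inc_right))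
    rw [Finset.prod_eq_mul (⟨x, h.left_mem⟩ : V(G)) ⟨y, h.right_mem⟩]
    · rw [if_neg (hl _), if_neg (hl _), if_pos h.inc_left, if_pos h.inc_right, pow_one, pow_one]
    · exact fun h' => hxy (congrArg Subtype.val h')
    · intro v _ hv
      rw [if_neg (hl _), if_neg, pow_zero]
      intro h'
      rcases h'.eq_or_eq_of_isLink h with h1 | h1
      · exact hv.1 (Subtype.ext h1)
      · exact hv.2 (Subtype.ext h1)
    · simp
    · simp

variable [Fintype E(G)] [Fintype V(G)]

/-- The sum over edge sets factors over the edges; a loop gives the same kind of factor with both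
ends equal. -/
theorem sum_prod_pow_deg_ne_zero (lam : E(G) → ℝ) (hlam : ∀ e, 0 ≤ lam e) (t : V(G) → ℂ)
    (ht : ∀ v, 0 < (t v).re) :
    ∑ H : Finset E(G), (∏ e ∈ H, (lam e : ℂ)) * ∏ v, t v ^ deg G H v ≠ 0 := by
  have h : ∑ H : Finset E(G), (∏ e ∈ H, (lam e : ℂ)) * ∏ v, t v ^ deg G H v
      = ∏ e : E(G), (1 + (lam e : ℂ) * ∏ v, t v ^ deg G {e} v) := by
    rw [Finset.prod_one_add, Finset.powerset_univ]
    refine Finset.sum_congr rfl fun H _ => ?_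
    rw [Finset.prod_mul_distrib, Finset.prod_comm]
    congr 1
    refine Finset.prod_congr rfl fun v _ => ?_
    rw [deg_eq_sum_singleton, Finset.prod_pow_eq_pow_sum]
  rw [h, Finset.prod_ne_zero_iff]
  intro e _
  obtain ⟨x, y, hxy⟩ := prod_pow_deg_singleton G t e
  rw [hxy]
  exact one_add_mul_mul_ne_zero (hlam e) (ht x) (ht y)

-- Induction on the set `s` of vertices whose powers have been replaced. The statement must hold for
-- all `t` so that, at the next vertex `a`, the value `t a` can serve as the variable of a
-- polynomial `p`; pairing `p` with `Q a` performs the replacement.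
open Classical in
theorem sum_prod_ite_activity_ne_zero (lam : E(G) → ℝ) (hlam : ∀ e, 0 ≤ lam e)
    (Q : V(G) → Polynomial ℂ) (hQd : ∀ v, (Q v).natDegree = deg G Finset.univ v)
    (hQ0 : ∀ v, Q v ≠ 0) (hQ : ∀ v, ∀ z : ℂ, 0 ≤ z.re → (Q v).eval z ≠ 0)
    (s : Finset V(G)) : ∀ t : V(G) → ℂ, (∀ v, 0 < (t v).re) →
    ∑ H : Finset E(G), (∏ e ∈ H, (lam e : ℂ)) *
      ∏ v, (if v ∈ s then
        (Q v).coeff (deg G H v) / ((deg G Finset.univ v).choose (deg G H v) : ℂ)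
        else t v ^ deg G H v) ≠ 0 := by
  induction s using Finset.induction with
  | empty =>
    intro t ht
    simpa using sum_prod_pow_deg_ne_zero G lam hlam t ht
  | insert a s ha ih =>
    intro t ht
    set d := deg G Finset.univ a with hd
    set A : Finset E(G) → ℂ := fun H => (∏ e ∈ H, (lam e : ℂ)) *
      ∏ v ∈ Finset.univ.erase a, (if v ∈ s then
        (Q v).coeff (deg G H v) / ((deg G Finset.univ v).choose (deg G H v) : ℂ)
        else t v ^ deg G H v) with hA
    set p : Polynomial ℂ := ∑ H : Finset E(G), Polynomial.monomial (deg G H a) (A H) with hp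
    have hle : ∀ H : Finset E(G), deg G H a ≤ d := fun H => deg_mono G (Finset.subset_univ H) a
    have hpd : p.natDegree ≤ d := by
      apply Polynomial.natDegree_sum_le_of_forall_le
      exact fun H _ => (Polynomial.natDegree_monomial_le _).trans (hle H)
    have hpe : ∀ z : ℂ, 0 < z.re → p.eval z ≠ 0 := by
      intro z hz
      have h1 := ih (Function.update t a z) (by
        intro v
        rcases eq_or_ne v a with rfl | hv
        · simpa using hz
        · simpa [hv] using ht v)
      rw [hp, Polynomial.eval_finsetSum]
      convert h1 using 2 with H _
      rw [Polynomial.eval_monomial, ← Finset.mul_prod_erase _ _ (Finset.mem_univ a), if_neg ha,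
        Function.update_self, hA]
      have h2 : ∏ v ∈ Finset.univ.erase a, (if v ∈ s then
            (Q v).coeff (deg G H v) / ((deg G Finset.univ v).choose (deg G H v) : ℂ)
            else Function.update t a z v ^ deg G H v)
          = ∏ v ∈ Finset.univ.erase a, (if v ∈ s then
            (Q v).coeff (deg G H v) / ((deg G Finset.univ v).choose (deg G H v) : ℂ)
            else t v ^ deg G H v) := by
        refine Finset.prod_congr rfl fun v hv => ?_
        rw [Function.update_of_ne (Finset.ne_of_mem_erase hv)]
      rw [h2]
      ring
    have key := apolar_pairing_ne_zero d p (Q a) hpd hpe (hQd a) (hQ0 a) (hQ a)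
    convert key using 1
    simp only [hp, Polynomial.finsetSum_coeff, Finset.sum_mul, Polynomial.coeff_monomial, ite_mul,
      zero_mul]
    rw [Finset.sum_comm]
    refine Finset.sum_congr rfl fun H _ => ?_
    rw [Finset.sum_ite_eq, if_pos (Finset.mem_range.2 (Nat.lt_succ_of_le (hle H))),
      ← Finset.mul_prod_erase _ _ (Finset.mem_univ a), if_pos (Finset.mem_insert_self a s), hA]
    have h2 : ∏ v ∈ Finset.univ.erase a, (if v ∈ insert a s then
          (Q v).coeff (deg G H v) / ((deg G Finset.univ v).choose (deg G H v) : ℂ)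
          else t v ^ deg G H v)
        = ∏ v ∈ Finset.univ.erase a, (if v ∈ s then
          (Q v).coeff (deg G H v) / ((deg G Finset.univ v).choose (deg G H v) : ℂ)
          else t v ^ deg G H v) := by
      refine Finset.prod_congr rfl fun v hv => ?_
      simp only [Finset.mem_insert, Finset.ne_of_mem_erase hv, false_or]
    rw [h2]
    ring

/-- If every `Q v` has full degree and all its zeros in the open left half-plane, the partition
function with key polynomials `Q` does not vanish at `1`. -/
theorem sum_prod_activity_ne_zero (lam : E(G) → ℝ) (hlam : ∀ e, 0 ≤ lam e)
    (Q : V(G) → Polynomial ℂ) (hQd : ∀ v, (Q v).natDegree = deg G Finset.univ v)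
    (hQ0 : ∀ v, Q v ≠ 0) (hQ : ∀ v, ∀ z : ℂ, 0 ≤ z.re → (Q v).eval z ≠ 0) :
    ∑ H : Finset E(G), (∏ e ∈ H, (lam e : ℂ)) *
      ∏ v, (Q v).coeff (deg G H v) / ((deg G Finset.univ v).choose (deg G H v) : ℂ) ≠ 0 := by
  simpa using sum_prod_ite_activity_ne_zero G lam hlam Q hQd hQ0 hQ Finset.univ (fun _ => 1)
    (by simp)

end Graphs

/-! ### Sectors -/

theorem mul_mem_sector {ε : ℝ} (hε : ε ≤ Real.pi / 2) {x z : ℂ} (hx : x ∈ sector ε)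
    (hz0 : z ≠ 0) (hz : 0 ≤ z.re) : x * z ∈ sector (Real.pi / 2 + ε) := by
  obtain ⟨hx0, hx⟩ := hx
  have hz' := abs_le.1 (Complex.abs_arg_le_pi_div_two_iff.2 hz)
  have hx' := abs_lt.1 hx
  refine ⟨mul_ne_zero hx0 hz0, ?_⟩
  rw [Complex.arg_mul hx0 hz0 ⟨by linarith, by linarith⟩, abs_lt]
  constructor <;> linarith

theorem isOpen_sector {ε : ℝ} (hε : ε ≤ Real.pi) : IsOpen (sector ε) := by
  have h : sector ε = Complex.slitPlane ∩ Complex.arg ⁻¹' Set.Ioo (-ε) ε := by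
    ext z
    simp only [sector, Set.mem_ofPred_eq, Set.mem_inter_iff, Set.mem_preimage, Set.mem_Ioo,
      Complex.mem_slitPlane_iff_arg, ← abs_lt]
    constructor
    · rintro ⟨h0, h⟩
      refine ⟨⟨fun h' => ?_, h0⟩, h⟩
      rw [h', abs_of_pos Real.pi_pos] at h
      linarith
    · rintro ⟨⟨_, h0⟩, h⟩
      exact ⟨h0, h⟩
  rw [h]
  exact ContinuousOn.isOpen_inter_preimage
    (fun z hz => (Complex.continuousAt_arg hz).continuousWithinAt) Complex.isOpen_slitPlane
    isOpen_Ioo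

theorem neg_ofReal_notMem_sector {θ r : ℝ} (hθ : θ ≤ Real.pi) (hr : 0 < r) :
    (-(r : ℂ)) ∉ sector θ := by
  rintro ⟨_, h⟩
  rw [← Complex.ofReal_neg, Complex.arg_ofReal_of_neg (neg_lt_zero.2 hr),
    abs_of_pos Real.pi_pos] at h
  linarith

/-! ### Limits of nonvanishing polynomials -/

/-- Every root `a` has `r ≤ ‖a‖`, so `‖t - a‖ ≤ ‖a‖ * (1 + ‖t‖ / r)`. The constant depends only on
`r`, `n` and `t`, so the bound survives limits; it takes the place of Hurwitz's theorem. -/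
theorem norm_eval_le_of_forall_ball_ne_zero {q : Polynomial ℂ} {n : ℕ} (hn : q.natDegree ≤ n)
    {r : ℝ} (hr : 0 < r) (hq : ∀ t : ℂ, ‖t‖ < r → q.eval t ≠ 0) (t : ℂ) :
    ‖q.eval t‖ ≤ ‖q.eval 0‖ * (1 + ‖t‖ / r) ^ n := by
  have key : ∀ s : Multiset ℂ, (∀ z ∈ s, r ≤ ‖z‖) →
      ‖(s.map fun z => t - z).prod‖
        ≤ ‖(s.map fun z => 0 - z).prod‖ * (1 + ‖t‖ / r) ^ Multiset.card s := by
    intro s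
    induction s using Multiset.induction with
    | empty => simp
    | cons a s ih =>
      intro hs
      have h1 := ih fun z hz => hs z (Multiset.mem_cons_of_mem hz)
      have h2 := hs a (Multiset.mem_cons_self a s)
      have h3 : ‖t - a‖ ≤ ‖0 - a‖ * (1 + ‖t‖ / r) := by
        rw [zero_sub, norm_neg]
        have h4 : ‖t‖ ≤ ‖a‖ * (‖t‖ / r) := by
          calc ‖t‖ = r * (‖t‖ / r) := by field_simp
            _ ≤ _ := by gcongr
        linarith [norm_sub_le t a]
      rw [Multiset.map_cons, Multiset.prod_cons, Multiset.map_cons, Multiset.prod_cons, norm_mul,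
        norm_mul, Multiset.card_cons, pow_succ]
      calc _ ≤ (‖0 - a‖ * (1 + ‖t‖ / r)) *
            (‖(s.map fun z => 0 - z).prod‖ * (1 + ‖t‖ / r) ^ Multiset.card s) := by gcongr
        _ = _ := by ring
  have h1 := key q.roots fun z hz => by
    by_contra! h
    exact hq z h (Polynomial.isRoot_of_mem_roots hz)
  rw [(IsAlgClosed.splits q).eval_eq_prod_roots, (IsAlgClosed.splits q).eval_eq_prod_roots,
    norm_mul, norm_mul, mul_assoc]
  gcongr
  refine h1.trans ?_
  gcongr
  · exact le_add_of_nonneg_right (by positivity)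
  · exact (Polynomial.card_roots' q).trans hn

theorem continuous_coeff_mul {X : Type*} [TopologicalSpace X] {P Q : X → Polynomial ℂ}
    (hP : ∀ n, Continuous fun x => (P x).coeff n) (hQ : ∀ n, Continuous fun x => (Q x).coeff n)
    (n : ℕ) : Continuous fun x => (P x * Q x).coeff n := by
  simp only [Polynomial.coeff_mul]
  exact continuous_finsetSum _ fun i _ => (hP _).mul (hQ _)

theorem continuous_coeff_pow {X : Type*} [TopologicalSpace X] {P : X → Polynomial ℂ}
    (hP : ∀ n, Continuous fun x => (P x).coeff n) (k : ℕ) :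
    ∀ n, Continuous fun x => (P x ^ k).coeff n := by
  induction k with
  | zero => simpa using fun n => continuous_const
  | succ k ih =>
    simp only [pow_succ]
    exact continuous_coeff_mul ih hP

/-- A polynomial of degree at most `d` without zeros in a sector is the limit of polynomials of
degree exactly `d` that have no zeros in the sector or at the origin. -/
theorem exists_family_ne_zero {d : ℕ} {K : Polynomial ℂ} (hKd : K.natDegree ≤ d) (hK0 : K ≠ 0)
    {θ : ℝ} (hθ : θ ≤ Real.pi) (hK : ∀ z ∈ sector θ, K.eval z ≠ 0) :
    ∃ Q : ℝ → Polynomial ℂ, (∀ n, Continuous fun δ => (Q δ).coeff n) ∧ Q 0 = K ∧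
      ∀ δ, 0 < δ → (Q δ).natDegree = d ∧ (Q δ).eval 0 ≠ 0 ∧
        ∀ z ∈ sector θ, (Q δ).eval z ≠ 0 := by
  obtain ⟨R, hR, hdvd⟩ := K.exists_eq_pow_rootMultiplicity_mul_and_not_dvd hK0 0
  set k := K.rootMultiplicity 0
  rw [Polynomial.C_0, sub_zero] at hR
  have hR0 : R ≠ 0 := by
    rintro rfl
    exact hK0 (by simpa using hR)
  have hRe : R.eval 0 ≠ 0 := fun h => hdvd (Polynomial.dvd_iff_isRoot.2 h)
  have hdeg : K.natDegree = k + R.natDegree := by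
    rw [hR, Polynomial.natDegree_mul (pow_ne_zero _ Polynomial.X_ne_zero) hR0,
      Polynomial.natDegree_X_pow]
  -- Zeros at the origin move to `-δ` and the missing zeros at infinity to `-1/δ`; the negative real
  -- axis is outside the sector.
  refine ⟨fun δ => (Polynomial.X + Polynomial.C (δ : ℂ)) ^ k * R *
    (Polynomial.C (δ : ℂ) * Polynomial.X + Polynomial.C 1) ^ (d - K.natDegree), ?_, ?_, ?_⟩
  · refine continuous_coeff_mul (continuous_coeff_mul (continuous_coeff_pow ?_ _)
      fun n => continuous_const) (continuous_coeff_pow ?_ _)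
    · intro n
      simp only [Polynomial.coeff_add, Polynomial.coeff_C]
      split_ifs <;> fun_prop
    · intro n
      simp only [Polynomial.coeff_add, Polynomial.coeff_C_mul]
      fun_prop
  · simp [← hR]
  · intro δ hδ
    have hδ0 : (δ : ℂ) ≠ 0 := Complex.ofReal_ne_zero.2 hδ.ne'
    have hlin : (Polynomial.C (δ : ℂ) * Polynomial.X + Polynomial.C 1).natDegree = 1 :=
      Polynomial.natDegree_linear hδ0
    have hlin0 : Polynomial.C (δ : ℂ) * Polynomial.X + Polynomial.C 1 ≠ 0 := by
      intro h
      rw [h] at hlin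
      simp at hlin
    have hX0 : Polynomial.X + Polynomial.C (δ : ℂ) ≠ 0 := Polynomial.X_add_C_ne_zero _
    have h1 := mul_ne_zero (pow_ne_zero k hX0) hR0
    refine ⟨?_, ?_, ?_⟩
    · rw [Polynomial.natDegree_mul h1 (pow_ne_zero _ hlin0),
        Polynomial.natDegree_mul (pow_ne_zero k hX0) hR0, Polynomial.natDegree_pow,
        Polynomial.natDegree_pow, Polynomial.natDegree_X_add_C, hlin]
      omega
    · simp [hRe, hδ0]
    · intro z hz
      have h2 : z + δ ≠ 0 := fun h => neg_ofReal_notMem_sector hθ hδ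
        (by rwa [← eq_neg_of_add_eq_zero_left h])
      have h3 : δ * z + 1 ≠ 0 := fun h => neg_ofReal_notMem_sector hθ (inv_pos.2 hδ) (by
        have : z = -((δ⁻¹ : ℝ) : ℂ) := by
          push_cast
          field_simp
          linear_combination h
        rwa [← this])
      have h4 : R.eval z ≠ 0 := fun h => hK z hz (by rw [hR, Polynomial.eval_mul, h, mul_zero])
      simp [h2, h3, h4]

/-! ### From key polynomials to the partition function -/

section Graphs

variable {α β : Type*} (G : Graph α β) [Fintype E(G)]

theorem coeff_keyPoly (u : V(G) → ℕ → ℂ) (v : V(G)) {j : ℕ} (hj : j ≤ deg G Finset.univ v) :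
    (keyPoly G u v).coeff j = ((deg G Finset.univ v).choose j : ℂ) * u v j := by
  simp only [keyPoly, Polynomial.finsetSum_coeff, Polynomial.coeff_C_mul_X_pow]
  rw [Finset.sum_ite_eq, if_pos (Finset.mem_range.2 (Nat.lt_succ_of_le hj))]

theorem natDegree_keyPoly_le (u : V(G) → ℕ → ℂ) (v : V(G)) :
    (keyPoly G u v).natDegree ≤ deg G Finset.univ v :=
  Polynomial.natDegree_sum_le_of_forall_le _ _ fun _ hj =>
    (Polynomial.natDegree_C_mul_X_pow_le _ _).trans (Nat.lt_succ_iff.1 (Finset.mem_range.1 hj))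

theorem coeff_keyPoly_div_choose (u : V(G) → ℕ → ℂ) (v : V(G)) (H : Finset E(G)) :
    (keyPoly G u v).coeff (deg G H v) / ((deg G Finset.univ v).choose (deg G H v) : ℂ)
      = u v (deg G H v) := by
  have h := deg_mono G (Finset.subset_univ H) v
  rw [coeff_keyPoly G u v h, mul_div_cancel_left₀]
  exact Nat.cast_ne_zero.2 (Nat.choose_pos h).ne'

variable [Fintype V(G)]

theorem eval_Z (lam : E(G) → ℂ) (u : V(G) → ℕ → ℂ) (x : V(G) → ℂ) :
    MvPolynomial.eval x (Z G lam u)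
      = ∑ H : Finset E(G), (∏ e ∈ H, lam e) * ∏ v, u v (deg G H v) * x v ^ deg G H v := by
  simp [Z, weight, Finset.prod_mul_distrib, mul_assoc]

theorem Z_eq_zero_of_keyPoly_eq_zero (lam : E(G) → ℂ) (u : V(G) → ℕ → ℂ) {v : V(G)}
    (hv : keyPoly G u v = 0) : Z G lam u = 0 := by
  refine Finset.sum_eq_zero fun H _ => ?_
  have h : u v (deg G H v) = 0 := by
    rw [← coeff_keyPoly_div_choose G u v H, hv, Polynomial.coeff_zero, zero_div]
  rw [weight, Finset.prod_eq_zero (Finset.mem_univ v) h, mul_zero, map_zero, zero_mul]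

/-- The factor `x v ^ j` is absorbed into the coefficients by passing to `Q v (x v * z)`, which has
no zeros in the closed right half-plane. -/
theorem sum_prod_activity_mul_pow_ne_zero {ε : ℝ} (hε : ε ≤ Real.pi / 2) (lam : E(G) → ℝ)
    (hlam : ∀ e, 0 ≤ lam e) (Q : V(G) → Polynomial ℂ)
    (hQd : ∀ v, (Q v).natDegree = deg G Finset.univ v)
    (hQe : ∀ v, (Q v).eval 0 ≠ 0)
    (hQ : ∀ v, ∀ z ∈ sector (Real.pi / 2 + ε), (Q v).eval z ≠ 0)
    (x : V(G) → ℂ) (hx : ∀ v, x v ∈ sector ε) :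
    ∑ H : Finset E(G), (∏ e ∈ H, (lam e : ℂ)) * ∏ v,
      (Q v).coeff (deg G H v) / ((deg G Finset.univ v).choose (deg G H v) : ℂ)
        * x v ^ deg G H v ≠ 0 := by
  have hd : ∀ v, ((Q v).comp (Polynomial.C (x v) * Polynomial.X)).natDegree
      = deg G Finset.univ v := by
    intro v
    rw [Polynomial.natDegree_comp, Polynomial.natDegree_C_mul_X _ (hx v).1, mul_one, hQd]
  have hz : ∀ v, ∀ z : ℂ, 0 ≤ z.re →
      ((Q v).comp (Polynomial.C (x v) * Polynomial.X)).eval z ≠ 0 := by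
    intro v z hz
    rw [Polynomial.eval_comp, Polynomial.eval_mul, Polynomial.eval_C, Polynomial.eval_X]
    rcases eq_or_ne z 0 with rfl | hz0
    · rw [mul_zero]
      exact hQe v
    · exact hQ v _ (mul_mem_sector hε (hx v) hz0 hz)
  have key := sum_prod_activity_ne_zero G lam hlam
    (fun v => (Q v).comp (Polynomial.C (x v) * Polynomial.X)) hd
    (fun v h => hz v 0 le_rfl (by rw [h, Polynomial.eval_zero])) hz
  simpa only [Polynomial.comp_C_mul_X_coeff, mul_div_right_comm] using key

/-- If all key polynomials are nonvanishing in the sector `S[π/2 + ε]`, then `Z` is nonvanishing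
in the sector `S[ε]`. -/
theorem nonvanishing_Z {ε : ℝ} (hε : ε ≤ Real.pi / 2) (lam : E(G) → ℝ) (hlam : ∀ e, 0 ≤ lam e)
    (u : V(G) → ℕ → ℂ)
    (hK : ∀ v, Nonvanishing₁ (sector (Real.pi / 2 + ε)) (keyPoly G u v)) :
    Nonvanishing (sector ε) (Z G (fun e => (lam e : ℂ)) u) := by
  by_cases hK0 : ∃ v, keyPoly G u v = 0
  · obtain ⟨v, hv⟩ := hK0
    exact Or.inl (Z_eq_zero_of_keyPoly_eq_zero G _ u hv)
  push Not at hK0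
  rw [Nonvanishing, or_iff_not_imp_left]
  intro hZ x hx hx0
  obtain ⟨y, hy⟩ : ∃ y, MvPolynomial.eval y (Z G (fun e => (lam e : ℂ)) u) ≠ 0 := by
    by_contra! h
    exact hZ (MvPolynomial.funext fun y => by rw [h y, map_zero])
  have hfam := fun v => exists_family_ne_zero (natDegree_keyPoly_le G u v) (hK0 v)
    (θ := Real.pi / 2 + ε) (by linarith) ((hK v).resolve_left (hK0 v))
  choose Q hQc hQ0 hQ using hfam
  -- Restrict to the complex line from the supposed zero `x` to a point `y` where `Z` does not
  -- vanish; near `x` the line stays in the sector.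
  obtain ⟨r, hr, hball⟩ : ∃ r > 0, ∀ t : ℂ, ‖t‖ < r → ∀ v, x v + t * (y v - x v) ∈ sector ε := by
    have h : ∀ᶠ t : ℂ in nhds 0, ∀ v, x v + t * (y v - x v) ∈ sector ε := by
      rw [Filter.eventually_all]
      intro v
      have hc : ContinuousAt (fun t : ℂ => x v + t * (y v - x v)) 0 := by fun_prop
      refine hc.eventually_mem ((isOpen_sector (by linarith [Real.pi_pos])).mem_nhds ?_)
      simpa using hx v
    obtain ⟨r, hr, h⟩ := Metric.eventually_nhds_iff.1 h
    exact ⟨r, hr, fun t ht => h (by simpa using ht)⟩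
  set c : ℝ → Finset E(G) → ℂ := fun δ H => (∏ e ∈ H, (lam e : ℂ)) *
    ∏ v, (Q v δ).coeff (deg G H v) / ((deg G Finset.univ v).choose (deg G H v) : ℂ) with hc
  have hcc : ∀ H, Continuous fun δ => c δ H := by
    intro H
    refine continuous_const.mul (continuous_finsetProd _ fun v _ => ?_)
    exact (hQc v _).div_const _
  have hc0 : ∀ z, ∑ H, c 0 H * ∏ v, z v ^ deg G H v
      = MvPolynomial.eval z (Z G (fun e => (lam e : ℂ)) u) := by
    intro z
    rw [eval_Z]
    simp only [hc, hQ0, coeff_keyPoly_div_choose, Finset.prod_mul_distrib, mul_assoc]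
  set q : ℝ → Polynomial ℂ := fun δ => ∑ H, Polynomial.C (c δ H) *
    ∏ v, (Polynomial.C (x v) + Polynomial.X * Polynomial.C (y v - x v)) ^ deg G H v with hq
  have hqe : ∀ δ t, (q δ).eval t = ∑ H, c δ H * ∏ v, (x v + t * (y v - x v)) ^ deg G H v := by
    intro δ t
    simp [hq, Polynomial.eval_finsetSum, Polynomial.eval_prod]
  have hqd : ∀ δ, (q δ).natDegree ≤ 2 * Fintype.card E(G) := by
    intro δ
    refine Polynomial.natDegree_sum_le_of_forall_le _ _ fun H _ => ?_
    refine (Polynomial.natDegree_C_mul_le _ _).trans ((Polynomial.natDegree_prod_le _ _).trans ?_)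
    calc _ ≤ ∑ v, deg G H v := Finset.sum_le_sum fun v _ => by
          refine Polynomial.natDegree_pow_le.trans ?_
          have h : (Polynomial.C (x v) + Polynomial.X * Polynomial.C (y v - x v)).natDegree ≤ 1 := by
            compute_degree
          nlinarith
      _ = 2 * H.card := sum_deg G H
      _ ≤ _ := Nat.mul_le_mul_left 2 (Finset.card_le_univ H)
  have hqc : ∀ t, Continuous fun δ => (q δ).eval t := by
    intro t
    simp only [hqe]
    exact continuous_finsetSum _ fun H _ => (hcc H).mul continuous_const
  have hbound : ∀ δ, 0 < δ → ‖(q δ).eval 1‖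
      ≤ ‖(q δ).eval 0‖ * (1 + ‖(1 : ℂ)‖ / r) ^ (2 * Fintype.card E(G)) := by
    intro δ hδ
    refine norm_eval_le_of_forall_ball_ne_zero (hqd δ) hr (fun t ht => ?_) 1
    rw [hqe]
    have h := sum_prod_activity_mul_pow_ne_zero G hε lam hlam (fun v => Q v δ)
      (fun v => (hQ v δ hδ).1) (fun v => (hQ v δ hδ).2.1)
      (fun v => (hQ v δ hδ).2.2) _ (hball t ht)
    simpa only [hc, Finset.prod_mul_distrib, mul_assoc] using h
  -- Letting `δ → 0` is legitimate since the constant is independent of `δ`; a zero of `Z` at `x`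
  -- then forces one at `y`.
  have hlim : ‖(q 0).eval 1‖
      ≤ ‖(q 0).eval 0‖ * (1 + ‖(1 : ℂ)‖ / r) ^ (2 * Fintype.card E(G)) := by
    refine le_of_tendsto_of_tendsto (b := nhdsWithin (0 : ℝ) (Set.Ioi 0))
      ((hqc 1).norm.continuousAt.mono_left nhdsWithin_le_nhds)
      (((hqc 0).norm.mul continuous_const).continuousAt.mono_left nhdsWithin_le_nhds) ?_
    filter_upwards [self_mem_nhdsWithin] with δ hδ using hbound δ hδ
  have h0 : (q 0).eval 0 = 0 := by
    simp only [hqe, zero_mul, add_zero, hc0, hx0]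
  rw [h0, norm_zero, zero_mul, norm_le_zero_iff, hqe] at hlim
  simp only [one_mul, add_sub_cancel, hc0] at hlim
  exact hy hlim

theorem nonvanishing_Z_uni {ε : ℝ} {lam : E(G) → ℂ} {u : V(G) → ℕ → ℂ}
    (hZ : Nonvanishing (sector ε) (Z G lam u)) : Nonvanishing₁ (sector (2 * ε)) (Z_uni G lam u) := by
  rcases hZ with hZ | hZ
  · exact Or.inl (Polynomial.funext fun y => by rw [Z_uni_eval, hZ, map_zero, Polynomial.eval_zero])
  · refine Or.inr fun y hy => ?_
    rw [Z_uni_eval]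
    refine hZ _ fun _ => ⟨?_, ?_⟩
    · rw [Complex.cpow_def_of_ne_zero hy.1]
      exact Complex.exp_ne_zero _
    · have h := abs_lt.1 hy.2
      have him : (Complex.log y * (1 / 2 : ℂ)).im = Complex.arg y / 2 := by
        rw [show (1 / 2 : ℂ) = ((1 / 2 : ℝ) : ℂ) by push_cast; rfl, Complex.im_mul_ofReal,
          Complex.log_im]
        ring
      have h1 := Complex.neg_pi_lt_arg y
      have h2 := Complex.arg_le_pi y
      have h3 := Real.pi_pos
      rw [Complex.cpow_def_of_ne_zero hy.1, Complex.arg_exp,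
        (toIocMod_eq_self Real.two_pi_pos).2 ⟨by rw [him]; linarith, by rw [him]; linarith⟩, him,
        abs_lt]
      constructor <;> linarith [h.1, h.2]

end Graphs

/-! ### Windows of binomial coefficients -/

/-- A polynomial of degree at most three with nonnegative coefficients satisfying the Hurwitz
condition has no zeros in the closed right half-plane. -/
theorem cubic_ne_zero {a b c e : ℝ} (ha : 0 < a) (hb : 0 ≤ b) (hc : 0 ≤ c) (he : 0 ≤ e)
    (hbc : 0 < c → 0 < b) (hH : 0 < e → a * e < b * c) {z : ℂ} (hz : 0 ≤ z.re) :
    (a : ℂ) + b * z + c * z ^ 2 + e * z ^ 3 ≠ 0 := by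
  intro h
  have h1 := congrArg Complex.re h
  have h2 := congrArg Complex.im h
  simp only [pow_succ, pow_zero, one_mul, Complex.add_re, Complex.add_im, Complex.mul_re,
    Complex.mul_im, Complex.ofReal_re, Complex.ofReal_im, Complex.zero_re, Complex.zero_im] at h1 h2
  set x := z.re
  set y := z.im
  have h3 : y * (b + 2 * c * x + e * (3 * x ^ 2 - y ^ 2)) = 0 := by linear_combination h2
  have h4 : a + b * x + c * (x ^ 2 - y ^ 2) + e * (x ^ 3 - 3 * x * y ^ 2) = 0 := by
    linear_combination h1
  rcases mul_eq_zero.1 h3 with hy | hy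
  · rw [hy] at h4
    have : 0 ≤ b * x + c * x ^ 2 + e * x ^ 3 := by positivity
    nlinarith
  · rcases he.eq_or_lt with he0 | he0
    · rw [← he0] at hy h4
      have hcx : 0 ≤ c * x := by positivity
      have hb0 : b = 0 := by nlinarith
      have hc0 : c = 0 := by
        by_contra hc0
        have := hbc (lt_of_le_of_ne hc (Ne.symm hc0))
        linarith
      rw [hb0, hc0] at h4
      linarith
    -- Eliminating `y ^ 2` between the real and imaginary parts leaves a polynomial in `x` whose
    -- constant term is the Hurwitz determinant and whose other coefficients are nonnegative.
    · have h5 : (b * c - a * e) + 2 * (c ^ 2 + b * e) * x + 8 * (c * e) * x ^ 2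
          + 8 * e ^ 2 * x ^ 3 = 0 := by
        linear_combination (-e) * h4 + (c + 3 * e * x) * hy
      have h6 : 0 ≤ 2 * (c ^ 2 + b * e) * x + 8 * (c * e) * x ^ 2 + 8 * e ^ 2 * x ^ 3 := by
        positivity
      linarith [hH he0]

/-- With `d = k + 3 + m`, the ratio of the right side to the left is `(k + 3)(m + 3) / ((k + 1)(m +
1))`. -/
theorem choose_mul_choose_add_three_lt {d k : ℕ} (h : k + 3 ≤ d) :
    d.choose k * d.choose (k + 3) < d.choose (k + 1) * d.choose (k + 2) := by
  obtain ⟨m, rfl⟩ := Nat.exists_eq_add_of_le h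
  have h1 := Nat.choose_succ_right_eq (k + 3 + m) k
  have h2 := Nat.choose_succ_right_eq (k + 3 + m) (k + 2)
  rw [show k + 3 + m - k = m + 3 by omega] at h1
  rw [show k + 3 + m - (k + 2) = m + 1 by omega] at h2
  have h3 : 0 < (k + 3 + m).choose k := Nat.choose_pos (by omega)
  have h4 : 0 < (k + 3 + m).choose (k + 2) := Nat.choose_pos (by omega)
  set A := (k + 3 + m).choose k
  set B := (k + 3 + m).choose (k + 1)
  set C := (k + 3 + m).choose (k + 2)
  set D := (k + 3 + m).choose (k + 2 + 1)
  have h5 : (k + 1) * (k + 3) * (A * D) = (k + 1) * (m + 1) * (A * C) := by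
    calc _ = (k + 1) * A * (D * (k + 2 + 1)) := by ring
      _ = _ := by rw [h2]; ring
  have h6 : (k + 1) * (k + 3) * (B * C) = (k + 3) * (m + 3) * (A * C) := by
    calc _ = (k + 3) * C * (B * (k + 1)) := by ring
      _ = _ := by rw [h1]; ring
  have h7 : 0 < A * C := Nat.mul_pos h3 h4
  refine lt_of_mul_lt_mul_left (a := (k + 1) * (k + 3)) ?_ (Nat.zero_le _)
  rw [h5, h6]
  refine Nat.mul_lt_mul_of_pos_right ?_ h7
  nlinarith

/-- The binomial generating polynomial `∑ binom(d,j) z^j` restricted to `k ≤ j ≤ l`. -/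
noncomputable def windowPoly (d k l : ℕ) : Polynomial ℂ :=
  ∑ j ∈ Finset.range (d + 1),
    Polynomial.C ((d.choose j : ℂ) * (if k ≤ j ∧ j ≤ l then 1 else 0)) * Polynomial.X ^ j

theorem windowPoly_eq_zero {d k : ℕ} (h : d < k) (l : ℕ) : windowPoly d k l = 0 := by
  refine Finset.sum_eq_zero fun j hj => ?_
  have hj' := Finset.mem_range.1 hj
  rw [if_neg (by omega), mul_zero, map_zero, zero_mul]

theorem eval_windowPoly {d k m : ℕ} (hm : m ≤ 3) (z : ℂ) :
    (windowPoly d k (k + m)).eval z = z ^ k * (((d.choose k : ℝ) : ℂ)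
      + ((if 1 ≤ m then (d.choose (k + 1) : ℝ) else 0 : ℝ) : ℂ) * z
      + ((if 2 ≤ m then (d.choose (k + 2) : ℝ) else 0 : ℝ) : ℂ) * z ^ 2
      + ((if 3 ≤ m then (d.choose (k + 3) : ℝ) else 0 : ℝ) : ℂ) * z ^ 3) := by
  have h1 : (windowPoly d k (k + m)).eval z
      = ∑ j ∈ Finset.range (d + 1),
        (d.choose j : ℂ) * (if k ≤ j ∧ j ≤ k + m then 1 else 0) * z ^ j := by
    simp [windowPoly, Polynomial.eval_finsetSum]
  have h2 : ∑ j ∈ Finset.range (d + 1),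
        (d.choose j : ℂ) * (if k ≤ j ∧ j ≤ k + m then 1 else 0) * z ^ j
      -- The range is enlarged so that, after shifting by `k`, all four indices of the window are
      -- present; the binomials beyond `d` are 0.
      = ∑ j ∈ Finset.range (k + (d + 4)),
        (d.choose j : ℂ) * (if k ≤ j ∧ j ≤ k + m then 1 else 0) * z ^ j := by
    refine Finset.sum_subset (Finset.range_subset_range.2 (by omega)) fun j _ hj => ?_
    rw [Nat.choose_eq_zero_of_lt (by simpa using hj)]
    simp
  have h3 : ∑ j ∈ Finset.range (k + (d + 4)),
        (d.choose j : ℂ) * (if k ≤ j ∧ j ≤ k + m then 1 else 0) * z ^ j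
      = ∑ i ∈ Finset.range 4, (d.choose (k + i) : ℂ) * (if i ≤ m then 1 else 0) * z ^ (k + i) := by
    rw [Finset.sum_range_add, Finset.sum_eq_zero, zero_add]
    · symm
      refine Finset.sum_subset_zero_on_sdiff (Finset.range_subset_range.2 (by omega)) ?_ ?_
      · intro i hi
        have : ¬ i ≤ m := by
          simp only [Finset.mem_sdiff, Finset.mem_range] at hi
          omega
        simp [this]
      · intro i _
        simp
    · intro j hj
      have : ¬ k ≤ j := by simpa using hj
      simp [this]
  rw [h1, h2, h3]
  simp only [Finset.sum_range_succ, Finset.sum_range_zero, Nat.zero_le, if_true, add_zero]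
  split_ifs <;> push_cast <;> ring

theorem windowPoly_eval_ne_zero {d k l : ℕ} (hk : k ≤ d) (hkl : k ≤ l) (hl : l ≤ k + 3) {z : ℂ}
    (hz0 : z ≠ 0) (hz : 0 ≤ z.re) : (windowPoly d k l).eval z ≠ 0 := by
  obtain ⟨m, rfl⟩ := Nat.exists_eq_add_of_le hkl
  rw [eval_windowPoly (by omega)]
  refine mul_ne_zero (pow_ne_zero _ hz0) (cubic_ne_zero ?_ ?_ ?_ ?_ ?_ ?_ hz)
  · exact_mod_cast Nat.choose_pos hk
  · positivity
  · positivity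
  · positivity
  · intro h
    split_ifs at h with hm
    · rw [if_pos (by omega)]
      have h' : 0 < d.choose (k + 2) := by exact_mod_cast h
      have := Nat.choose_ne_zero_iff.1 h'.ne'
      exact_mod_cast Nat.choose_pos (by omega)
    · exact absurd h (lt_irrefl _)
  · intro h
    split_ifs at h with hm
    · rw [if_pos hm, if_pos (by omega), if_pos (by omega)]
      have h' : 0 < d.choose (k + 3) := by exact_mod_cast h
      have := Nat.choose_ne_zero_iff.1 h'.ne'
      exact_mod_cast choose_mul_choose_add_three_lt this
    · exact absurd h (lt_irrefl _)

/-- A nonzero polynomial has finitely many roots, and each nonzero one has `|arg|` strictly above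
`π/2`, which leaves a positive margin. -/
theorem eventually_nonvanishing₁_sector {K : Polynomial ℂ}
    (hK : K = 0 ∨ ∀ z : ℂ, z ≠ 0 → 0 ≤ z.re → K.eval z ≠ 0) :
    ∀ᶠ ε : ℝ in nhdsWithin 0 (Set.Ioi 0), Nonvanishing₁ (sector (Real.pi / 2 + ε)) K := by
  by_cases hK0 : K = 0
  · exact Filter.Eventually.of_forall fun _ => Or.inl hK0
  have hK' := hK.resolve_left hK0
  have h : ∀ᶠ ε : ℝ in nhdsWithin 0 (Set.Ioi 0), ∀ ρ ∈ K.roots.toFinset,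
      ρ ≠ 0 → Real.pi / 2 + ε ≤ |Complex.arg ρ| := by
    rw [Filter.eventually_all_finset]
    intro ρ hρ
    by_cases hρ0 : ρ = 0
    · exact Filter.Eventually.of_forall fun _ h => absurd hρ0 h
    have harg : Real.pi / 2 < |Complex.arg ρ| := by
      by_contra! h
      exact hK' ρ hρ0 (Complex.abs_arg_le_pi_div_two_iff.1 h)
        (Polynomial.isRoot_of_mem_roots (Multiset.mem_toFinset.1 hρ))
    filter_upwards [nhdsWithin_le_nhds (Iio_mem_nhds (sub_pos.2 harg))] with ε hε _
    have := Set.mem_Iio.1 hε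
    linarith
  filter_upwards [h] with ε hε
  refine Or.inr fun z hz h0 => ?_
  have := hε z (by simpa using ⟨hK0, h0⟩) hz.1
  linarith [hz.2]

/-- A common sector for all windows of width at most three of binomial coefficients of bounded
degree. -/
theorem exists_sector_windowPoly (Δ : ℕ) : ∃ ε : ℝ, 0 < ε ∧ ε ≤ Real.pi / 2 ∧
    ∀ d ≤ Δ, ∀ k l, k ≤ l → l ≤ k + 3 →
      Nonvanishing₁ (sector (Real.pi / 2 + ε)) (windowPoly d k l) := by
  -- Only `k ≤ d ≤ Δ`, hence `l ≤ Δ + 3`, needs attention: a window starting beyond `d` is the zero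
  -- polynomial.
  have h : ∀ᶠ ε : ℝ in nhdsWithin 0 (Set.Ioi 0), ∀ d ∈ Finset.range (Δ + 1),
      ∀ k ∈ Finset.range (Δ + 1), ∀ l ∈ Finset.range (Δ + 4), k ≤ d ∧ k ≤ l ∧ l ≤ k + 3 →
        Nonvanishing₁ (sector (Real.pi / 2 + ε)) (windowPoly d k l) := by
    simp only [Filter.eventually_all_finset]
    intro d _ k _ l _
    rw [Filter.eventually_imp_distrib_left]
    rintro ⟨hk, hkl, hl⟩
    exact eventually_nonvanishing₁_sector
      (Or.inr fun z hz0 hz => windowPoly_eval_ne_zero hk hkl hl hz0 hz)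
  obtain ⟨ε, h, hε0, hε⟩ := (h.and (Ioc_mem_nhdsGT Real.pi_div_two_pos)).exists
  refine ⟨ε, hε0, hε, fun d hd k l hkl hl => ?_⟩
  by_cases hk : k ≤ d
  · exact h d (Finset.mem_range.2 (by omega)) k (Finset.mem_range.2 (by omega)) l
      (Finset.mem_range.2 (by omega)) ⟨hk, hkl, hl⟩
  · exact Or.inl (windowPoly_eq_zero (by omega) l)

end SpanningSubgraph

theorem mainTheorem7 (Δ : ℕ) :
    ∃ ε : ℝ, 0 < ε ∧ ε ≤ Real.pi / 2 ∧
      ∀ (α : Type*) (β : Type*) (G : Graph α β) [Fintype V(G)] [Fintype E(G)]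
        (lam : E(G) → ℝ) (f g : V(G) → ℕ),
        (∀ e, 0 ≤ lam e) →
        (∀ v, SpanningSubgraph.deg G Finset.univ v ≤ Δ) →
        (∀ v, f v ≤ g v ∧ g v ≤ f v + 3) →
        (∀ v, SpanningSubgraph.Nonvanishing₁ (SpanningSubgraph.sector (Real.pi / 2 + ε))
          (SpanningSubgraph.keyPoly G (SpanningSubgraph.indicatorActivity f g) v)) ∧
        SpanningSubgraph.Nonvanishing (SpanningSubgraph.sector ε)
          (SpanningSubgraph.Z G (fun e => (lam e : ℂ))
            (SpanningSubgraph.indicatorActivity f g)) ∧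
        SpanningSubgraph.Nonvanishing₁ (SpanningSubgraph.sector (2 * ε))
          (SpanningSubgraph.Z_uni G (fun e => (lam e : ℂ))
            (SpanningSubgraph.indicatorActivity f g)) := by
  obtain ⟨ε, hε0, hε, h⟩ := SpanningSubgraph.exists_sector_windowPoly Δ
  refine ⟨ε, hε0, hε, fun α β G _ _ lam f g hlam hdeg hfg => ?_⟩
  have hK : ∀ v, SpanningSubgraph.Nonvanishing₁ (SpanningSubgraph.sector (Real.pi / 2 + ε))
      (SpanningSubgraph.keyPoly G (SpanningSubgraph.indicatorActivity f g) v) :=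
    -- The key polynomial of the indicator activity is definitionally `windowPoly` with `d = deg(G,
    -- v)`.
    fun v => h _ (hdeg v) (f v) (g v) (hfg v).1 (hfg v).2
  have hZ := SpanningSubgraph.nonvanishing_Z G hε lam hlam _ hK
  exact ⟨hK, hZ, SpanningSubgraph.nonvanishing_Z_uni G hZ⟩
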